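/- Let $\Bbbk$ be an algebraically closed field of characteristic zero, $A$ a Hopf algebra over $\Bbbk$, $\sigma$ an algebra automorphism of $A$, and $A[x,\sigma]$ the Ore extension of $A$ with $xa=\sigma(a)x$ for $a\in A$. Suppose that $A[x,\sigma]$ is a Hopf-Ore extension of $A$, that is, it carries a Hopf algebra structure which extends that of $A$ and satisfies $\Delta(x)=x\otimes 1+g\otimes x$ for a group-like element $g\in A$. Let $\chi=\varepsilon\circ\sigma\colon A\to\Bbbk$, which is the unique character of $A$ with $\sigma(a)=\chi(a_1)a_2$ for all $a\in A$ (it also satisfies $\sigma(a)=g a_1 g^{-1}\chi(a_2)$), and put $q=\chi(g)\in\Bbbk^\times$. Let $R$ be a unital associative $\Bbbk$-algebra with center $Z(R)$. A partial action of a Hopf algebra $H$ on $R$ is a linear map $\cdot\colon H\otimes R\to R$ with $1_H\cdot r=r$, $h\cdot(rs)=(h_1\cdot r)(h_2\cdot s)$ and $h\cdot(l\cdot r)=(h_1\cdot 1_R)(h_2l\cdot r)$ for all $h,l\in H$, $r,s\in R$; it is symmetric if moreover $h\cdot(l\cdot r)=(h_1l\cdot r)(h_2\cdot 1_R)$ for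 all $h,l\in H$, $r\in R$. The $p$-binomial coefficients are given by $\binom{0}{0}_p=1$, $\binom{n}{m}_p=0$ if $m<0$ or $m>n$, and $\binom{n}{m}_p=\binom{n-1}{m}_p+p^{\,n-m}\binom{n-1}{m-1}_p$ for $n\ge 1$ and $0\le m\le n$. **Theorem.** Let $\cdot\colon A[x,\sigma]\otimes R\to R$ be a linear map such that $x\cdot 1_R\in Z(R)$, $g\cdot 1_R=0$, and $ga\cdot r=ag\cdot r$ for all $a\in A$ and $r\in R$. Then $\cdot$ is a partial action of $A[x,\sigma]$ on $R$ if and only if the following three conditions hold: 1. the restriction of $\cdot$ to $A\otimes R$ is a partial action of $A$ on $R$; 2. $a\cdot(x\cdot 1_R)=(\sigma^{-1}(a)\cdot 1_R)(x\cdot 1_R)$ for all $a\in A$; 3. with $w=x\cdot 1_R$, for all $j\ge 0$, $a\in A$ and $r\in R$, $$x^ja\cdot r=\sum_{i=0}^{j}(-1)^i q^{-\frac{i(i-1)}{2}}\binom{j}{i}_{q^{-1}} w^{j-i}\,(g^ia\cdot r)\,w^i .$$ Likewise, $\cdot$ is a symmetric partial action of $A[x,\sigma]$ on $R$ if and only if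 its restriction to $A\otimes R$ is a symmetric partial action of $A$ on $R$ and conditions 2 and 3 hold. -/

import Mathlib

open scoped TensorProduct

noncomputable section

/-! ### Gaussian binomial coefficients -/

/-- The `q`-binomial coefficient `binom(n, m)_q`, given by `binom(n, 0)_q = 1`, by
`binom(0, m)_q = 0` for `m > 0`, and by
`binom(n, m)_q = binom(n-1, m)_q + q ^ (n-m) * binom(n-1, m-1)_q`. -/
def qBinom {k : Type*} [Field k] (q : k) : ℕ → ℕ → k
  | _, 0 => 1
  | 0, _ + 1 => 0
  | n + 1, m + 1 => qBinom q n (m + 1) + q ^ (n - m) * qBinom q n m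

theorem qBinom_eq_zero_of_lt {k : Type*} [Field k] (q : k) :
    ∀ n m : ℕ, n < m → qBinom q n m = 0
  | _, 0, h => absurd h (Nat.not_lt_zero _)
  | 0, _ + 1, _ => by simp [qBinom]
  | n + 1, m + 1, h => by
      rw [qBinom, qBinom_eq_zero_of_lt q n (m + 1) (by omega),
        qBinom_eq_zero_of_lt q n m (by omega)]
      simp

/-! ### Partial actions of bialgebras -/

section PartialAction

variable {k H R : Type*} [Field k] [Ring H] [Bialgebra k H] [Ring R] [Algebra k R]

/-- A left partial action of the bialgebra `H` on the algebra `R`. The linear map `H ⊗ R → R` is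
given in curried form; `act h r` is `h · r`. In Sweedler's notation, the last two conditions are
`h · (r s) = (h₁ · r) (h₂ · s)` and `h · (l · r) = (h₁ · 1) (h₂ l · r)`. -/
structure IsPartialAction (act : H →ₗ[k] R →ₗ[k] R) : Prop where
  one_act : ∀ r : R, act 1 r = r
  act_mul : ∀ (h : H) (r s : R), act h (r * s) =
    LinearMap.mul' k R
      (TensorProduct.map (act.flip r) (act.flip s) (Coalgebra.comul (R := k) h))
  act_act : ∀ (h l : H) (r : R), act h (act l r) =
    LinearMap.mul' k R
      (TensorProduct.map (act.flip 1) (act.flip r ∘ₗ LinearMap.mulRight k l)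
        (Coalgebra.comul (R := k) h))

/-- A partial action is symmetric if moreover `h · (l · r) = (h₁ l · r) (h₂ · 1)`. -/
structure IsSymmetricPartialAction (act : H →ₗ[k] R →ₗ[k] R) : Prop
    extends IsPartialAction act where
  act_act_symm : ∀ (h l : H) (r : R), act h (act l r) =
    LinearMap.mul' k R
      (TensorProduct.map (act.flip r ∘ₗ LinearMap.mulRight k l) (act.flip 1)
        (Coalgebra.comul (R := k) h))

end PartialAction

/-! ### The Ore extension `A[x, σ]` -/

section OreAlgebra

variable {k A : Type*} [Field k] [Ring A] [Algebra k A]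

/-- A copy of `A`, on which `Multiplicative ℕ` acts through the powers of `σ`. -/
def OreCoeff (_σ : A ≃ₐ[k] A) : Type _ := A

instance (σ : A ≃ₐ[k] A) : Ring (OreCoeff σ) := inferInstanceAs (Ring A)

instance (σ : A ≃ₐ[k] A) : MulSemiringAction (Multiplicative ℕ) (OreCoeff σ) where
  smul n a := (σ ^ n.toAdd : A ≃ₐ[k] A) (show A from a)
  one_smul a := by
    change (σ ^ 0 : A ≃ₐ[k] A) (show A from a) = a
    rw [pow_zero, AlgEquiv.one_apply]
  mul_smul m n a := by
    change (σ ^ (m.toAdd + n.toAdd) : A ≃ₐ[k] A) (show A from a) =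
      (σ ^ m.toAdd : A ≃ₐ[k] A) ((σ ^ n.toAdd : A ≃ₐ[k] A) (show A from a))
    rw [pow_add, AlgEquiv.mul_apply]
  smul_zero n := map_zero (σ ^ n.toAdd : A ≃ₐ[k] A)
  smul_add n a b := map_add (σ ^ n.toAdd : A ≃ₐ[k] A) (show A from a) (show A from b)
  smul_one n := map_one (σ ^ n.toAdd : A ≃ₐ[k] A)
  smul_mul n a b := map_mul (σ ^ n.toAdd : A ≃ₐ[k] A) (show A from a) (show A from b)

/-- The Ore extension `A[x, σ]` (with zero derivation): the ring of skew polynomials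
`∑ aᵢ xⁱ` with coefficients in `A` and `x a = σ(a) x`. Only its ring structure is declared here;
its `k`-algebra structure is a part of the Hopf algebra structure in `HopfOreExtension`. -/
def OreExt (σ : A ≃ₐ[k] A) : Type _ := SkewPolynomial (OreCoeff σ)

instance (σ : A ≃ₐ[k] A) : Ring (OreExt σ) :=
  inferInstanceAs (Ring (SkewMonoidAlgebra (OreCoeff σ) (Multiplicative ℕ)))

namespace OreExt

/-- The inclusion `A → A[x, σ]`. -/
def C (σ : A ≃ₐ[k] A) : A →+* OreExt σ :=
  (SkewPolynomial.CRingHom : OreCoeff σ →+* SkewPolynomial (OreCoeff σ))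

/-- The variable `x` of `A[x, σ]`. -/
def X (σ : A ≃ₐ[k] A) : OreExt σ := (SkewPolynomial.X : SkewPolynomial (OreCoeff σ))

/-- The coefficients `aᵢ` of `∑ aᵢ xⁱ`. -/
def coeff (σ : A ≃ₐ[k] A) (p : OreExt σ) (n : ℕ) : A :=
  SkewPolynomial.coeff (show SkewPolynomial (OreCoeff σ) from p) n

theorem X_mul_C (σ : A ≃ₐ[k] A) (a : A) : X σ * C σ a = C σ (σ a) * X σ := by
  have h1 : ∀ a b : OreCoeff σ, b = SkewPolynomial.φ a →
      (SkewPolynomial.X : SkewPolynomial (OreCoeff σ)) * SkewPolynomial.CRingHom a =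
        SkewPolynomial.CRingHom b * SkewPolynomial.X := by
    rintro a b rfl
    rw [SkewPolynomial.CRingHom_eq_C, SkewPolynomial.CRingHom_eq_C, SkewPolynomial.X,
      SkewPolynomial.monomial_mul_C, SkewPolynomial.C_mul_monomial, Function.iterate_one,
      one_mul, mul_one]
  exact h1 a (σ a) (congrArg (fun τ : A ≃ₐ[k] A => τ a) (pow_one σ).symm)

theorem coeff_add (σ : A ≃ₐ[k] A) (p q : OreExt σ) (n : ℕ) :
    coeff σ (p + q) n = coeff σ p n + coeff σ q n :=
  SkewPolynomial.coeff_add (R := OreCoeff σ) p q n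

theorem coeff_C_mul (σ : A ≃ₐ[k] A) (a : A) (p : OreExt σ) (n : ℕ) :
    coeff σ (C σ a * p) n = a * coeff σ p n :=
  SkewMonoidAlgebra.coeff_single_one_mul (k := OreCoeff σ) (G := Multiplicative ℕ) p a
    (Multiplicative.ofAdd n)

theorem coeff_X_pow (σ : A ≃ₐ[k] A) (m n : ℕ) :
    coeff σ (X σ ^ m) n = if m = n then 1 else 0 := by
  have h1 : SkewPolynomial.coeff ((SkewPolynomial.X : SkewPolynomial (OreCoeff σ)) ^ m) n =
      if m = n then 1 else 0 := by
    rw [← SkewPolynomial.monomial_one_right_eq_X_pow, SkewPolynomial.coeff_monomial]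
  exact h1

theorem ext_coeff (σ : A ≃ₐ[k] A) {p q : OreExt σ} (h : ∀ n, coeff σ p n = coeff σ q n) :
    p = q :=
  SkewPolynomial.ext (R := OreCoeff σ) h

end OreExt

end OreAlgebra

/-! ### Hopf-Ore extensions -/

section HopfOre

variable {k A : Type*} [Field k] [Ring A] [HopfAlgebra k A]

/-- `A[x, σ]`, with the given Hopf algebra structure, is a Hopf-Ore extension of the Hopf
algebra `A`: the structure extends the one of `A` (the inclusion `A → A[x, σ]` is a homomorphism
of bialgebras over `k`, so that it also commutes with the antipodes), the element `g` of `A` is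
group-like, and `Δ(x) = x ⊗ 1 + g ⊗ x`. -/
structure HopfOreExtension (σ : A ≃ₐ[k] A) (g : A) [HopfAlgebra k (OreExt σ)] where
  incl : A →ₐc[k] OreExt σ
  incl_apply : ∀ a : A, incl a = OreExt.C σ a
  isGroupLike : IsGroupLikeElem k g
  comul_X : Coalgebra.comul (R := k) (OreExt.X σ) =
    OreExt.X σ ⊗ₜ[k] (1 : OreExt σ) + OreExt.C σ g ⊗ₜ[k] OreExt.X σ

/-- The character `χ = ε ∘ σ` of `A`. It is the only character with `σ(a) = χ(a₁) a₂`, and for a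
Hopf-Ore extension it satisfies `σ(a) = χ(a₁) a₂` and `σ(a) = g a₁ g⁻¹ χ(a₂)`; see the lemmas
below. -/
def oreCharacter (σ : A ≃ₐ[k] A) : A →ₐ[k] k :=
  (Bialgebra.counitAlgHom k A).comp σ.toAlgHom

theorem eq_oreCharacter (σ : A ≃ₐ[k] A) (χ : A →ₐ[k] k)
    (h : ∀ a, σ a = TensorProduct.lid k A
      (TensorProduct.map χ.toLinearMap LinearMap.id (Coalgebra.comul (R := k) a))) :
    χ = oreCharacter σ := by
  ext a
  have h2 : ∀ t : A ⊗[k] A, Coalgebra.counit (R := k) (TensorProduct.lid k A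
      (TensorProduct.map χ.toLinearMap LinearMap.id t)) =
      χ (TensorProduct.rid k A (TensorProduct.map LinearMap.id
        (Coalgebra.counit (R := k) (A := A)) t)) := by
    intro t
    induction t with
    | zero => simp
    | tmul x y => simp [mul_comm]
    | add x y hx hy => simp only [map_add, hx, hy]
  have h3 : TensorProduct.rid k A (TensorProduct.map LinearMap.id
        (Coalgebra.counit (R := k) (A := A)) (Coalgebra.comul (R := k) a)) = a := by
    have := Coalgebra.lTensor_counit_comul (R := k) a
    rw [LinearMap.lTensor] at this
    rw [this]; simp
  change χ a = Coalgebra.counit (R := k) (σ a)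
  rw [h a, h2, h3]

/-- The `n`-th coefficient, as a `k`-linear map. -/
def HopfOreExtension.coeffLinear {σ : A ≃ₐ[k] A} {g : A} [HopfAlgebra k (OreExt σ)]
    (E : HopfOreExtension σ g) (n : ℕ) : OreExt σ →ₗ[k] A where
  toFun p := OreExt.coeff σ p n
  map_add' p q := OreExt.coeff_add σ p q n
  map_smul' c p := by
    rw [Algebra.smul_def, Algebra.smul_def, ← AlgHomClass.commutes E.incl c, E.incl_apply,
      OreExt.coeff_C_mul, RingHom.id_apply]

theorem HopfOreExtension.comul_mul_map {σ : A ≃ₐ[k] A} {g : A} [HopfAlgebra k (OreExt σ)]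
    (E : HopfOreExtension σ g) (a : A) :
    Coalgebra.comul (R := k) (σ a) =
      TensorProduct.map σ.toLinearMap LinearMap.id (Coalgebra.comul (R := k) a) ∧
    Coalgebra.comul (R := k) (σ a) * g ⊗ₜ[k] (1 : A) =
      g ⊗ₜ[k] (1 : A) * TensorProduct.map LinearMap.id σ.toLinearMap
        (Coalgebra.comul (R := k) a) := by
  have hC : ∀ b : A, Coalgebra.comul (R := k) (OreExt.C σ b) =
      TensorProduct.map (E.incl : A →ₗ[k] OreExt σ) (E.incl : A →ₗ[k] OreExt σ)
        (Coalgebra.comul (R := k) b) := by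
    intro b
    rw [← E.incl_apply]
    exact (CoalgHomClass.map_comp_comul_apply E.incl b).symm
  have hE : ∀ b : A, (E.incl : A →ₗ[k] OreExt σ) b = OreExt.C σ b := E.incl_apply
  have hc1 : ∀ (n : ℕ) (b : A), E.coeffLinear n (OreExt.C σ b) = if 0 = n then b else 0 := by
    intro n b
    have := OreExt.coeff_C_mul σ b (OreExt.X σ ^ 0) n
    rw [OreExt.coeff_X_pow, pow_zero, mul_one] at this
    change OreExt.coeff σ (OreExt.C σ b) n = _
    rw [this]; split_ifs <;> simp
  have hc2 : ∀ (n : ℕ) (b : A), E.coeffLinear n (OreExt.C σ b * OreExt.X σ) =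
      if 1 = n then b else 0 := by
    intro n b
    have := OreExt.coeff_C_mul σ b (OreExt.X σ ^ 1) n
    rw [OreExt.coeff_X_pow, pow_one] at this
    change OreExt.coeff σ (OreExt.C σ b * OreExt.X σ) n = _
    rw [this]; split_ifs <;> simp
  have key := congrArg (Coalgebra.comul (R := k)) (OreExt.X_mul_C σ a)
  rw [Bialgebra.comul_mul, Bialgebra.comul_mul, E.comul_X, hC, hC] at key
  have hl : ∀ (m n : ℕ) (t : A ⊗[k] A), TensorProduct.map (E.coeffLinear m) (E.coeffLinear n)
      ((OreExt.X σ ⊗ₜ[k] (1 : OreExt σ) + OreExt.C σ g ⊗ₜ[k] OreExt.X σ) *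
        TensorProduct.map (E.incl : A →ₗ[k] OreExt σ) (E.incl : A →ₗ[k] OreExt σ) t) =
      (if 1 = m ∧ 0 = n then TensorProduct.map σ.toLinearMap LinearMap.id t else 0) +
      (if 0 = m ∧ 1 = n then
        g ⊗ₜ[k] (1 : A) * TensorProduct.map LinearMap.id σ.toLinearMap t else 0) := by
    intro m n t
    induction t with
    | zero => simp
    | tmul x y =>
      simp only [TensorProduct.map_tmul, hE, add_mul, Algebra.TensorProduct.tmul_mul_tmul,
        one_mul, OreExt.X_mul_C, ← map_mul, map_add, hc1, hc2, LinearMap.id_apply]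
      rcases m with _ | _ | m <;> rcases n with _ | _ | n <;> simp
    | add x y hx hy =>
      rw [map_add, mul_add, map_add, hx, hy, map_add, map_add, mul_add]
      split_ifs <;> abel
  have hr : ∀ (m n : ℕ) (t : A ⊗[k] A), TensorProduct.map (E.coeffLinear m) (E.coeffLinear n)
      (TensorProduct.map (E.incl : A →ₗ[k] OreExt σ) (E.incl : A →ₗ[k] OreExt σ) t *
        (OreExt.X σ ⊗ₜ[k] (1 : OreExt σ) + OreExt.C σ g ⊗ₜ[k] OreExt.X σ)) =
      (if 1 = m ∧ 0 = n then t else 0) +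
      (if 0 = m ∧ 1 = n then t * g ⊗ₜ[k] (1 : A) else 0) := by
    intro m n t
    induction t with
    | zero => simp
    | tmul x y =>
      simp only [TensorProduct.map_tmul, hE, mul_add, Algebra.TensorProduct.tmul_mul_tmul,
        mul_one, ← map_mul, map_add, hc1, hc2]
      rcases m with _ | _ | m <;> rcases n with _ | _ | n <;> simp
    | add x y hx hy =>
      rw [map_add, add_mul, map_add, hx, hy, add_mul]
      split_ifs <;> abel
  constructor
  · have h := congrArg (TensorProduct.map (E.coeffLinear 1) (E.coeffLinear 0)) key
    rw [hl, hr] at h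
    simpa using h.symm
  · have h := congrArg (TensorProduct.map (E.coeffLinear 0) (E.coeffLinear 1)) key
    rw [hl, hr] at h
    simpa using h.symm

/-- For a Hopf-Ore extension, `σ(a) = χ(a₁) a₂`. -/
theorem HopfOreExtension.sigma_eq {σ : A ≃ₐ[k] A} {g : A} [HopfAlgebra k (OreExt σ)]
    (E : HopfOreExtension σ g) (a : A) : σ a = TensorProduct.lid k A
      (TensorProduct.map (oreCharacter σ).toLinearMap LinearMap.id
        (Coalgebra.comul (R := k) a)) := by
  have h1 := Coalgebra.rTensor_counit_comul (R := k) (σ a)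
  rw [(E.comul_mul_map a).1, LinearMap.rTensor, ← LinearMap.comp_apply,
    ← TensorProduct.map_comp] at h1
  have h2 := congrArg (TensorProduct.lid k A) h1
  rw [TensorProduct.lid_tmul, one_smul, LinearMap.id_comp] at h2
  exact h2.symm

/-- For a Hopf-Ore extension, `σ(a) g = g a₁ χ(a₂)`. -/
theorem HopfOreExtension.sigma_mul_eq {σ : A ≃ₐ[k] A} {g : A} [HopfAlgebra k (OreExt σ)]
    (E : HopfOreExtension σ g) (a : A) : σ a * g = g * TensorProduct.rid k A
      (TensorProduct.map LinearMap.id (oreCharacter σ).toLinearMap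
        (Coalgebra.comul (R := k) a)) := by
  have h1 : ∀ t : A ⊗[k] A, TensorProduct.rid k A (TensorProduct.map LinearMap.id
      (Coalgebra.counit (R := k) (A := A)) (t * g ⊗ₜ[k] (1 : A))) =
      TensorProduct.rid k A (TensorProduct.map LinearMap.id
        (Coalgebra.counit (R := k) (A := A)) t) * g := by
    intro t
    induction t with
    | zero => simp
    | tmul x y => simp
    | add x y hx hy => simp only [add_mul, map_add, hx, hy]
  have h2 : ∀ t : A ⊗[k] A, TensorProduct.rid k A (TensorProduct.map LinearMap.id
      (Coalgebra.counit (R := k) (A := A)) (g ⊗ₜ[k] (1 : A) *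
        TensorProduct.map LinearMap.id σ.toLinearMap t)) =
      g * TensorProduct.rid k A (TensorProduct.map LinearMap.id
        (oreCharacter σ).toLinearMap t) := by
    intro t
    induction t with
    | zero => simp
    | tmul x y => simp [oreCharacter]
    | add x y hx hy => simp only [mul_add, map_add, hx, hy]
  have h3 := Coalgebra.lTensor_counit_comul (R := k) (σ a)
  rw [LinearMap.lTensor] at h3
  rw [← h2, ← (E.comul_mul_map a).2, h1, h3]
  simp

/-- The map `act` is given by the extension formula with parameters `q` and `w`:
`xʲ a · r = ∑ i ≤ j, (-1)^i q^(-i(i-1)/2) binom(j, i)_{q⁻¹} w^(j-i) (gⁱ a · r) wⁱ`. -/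
def IsOreFormula {R : Type*} [Ring R] [Algebra k R] (σ : A ≃ₐ[k] A) (g : A)
    [HopfAlgebra k (OreExt σ)] (act : OreExt σ →ₗ[k] R →ₗ[k] R) (q : k) (w : R) : Prop :=
  ∀ (j : ℕ) (a : A) (r : R), act (OreExt.X σ ^ j * OreExt.C σ a) r =
    ∑ i ∈ Finset.range (j + 1),
      ((-1) ^ i * q⁻¹ ^ (i * (i - 1) / 2) * qBinom q⁻¹ j i) •
        (w ^ (j - i) * act (OreExt.C σ (g ^ i * a)) r * w ^ i)

end HopfOre

end

/-! Write `w = x · 1`, `τ = σ⁻¹` and `fⱼ = (1 - q¹⁻ʲ g) ⋯ (1 - q⁻¹ g)(1 - g)`. Since `w` is central,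
the q-binomial theorem turns condition 3 into `xʲ a · r = wʲ (fⱼ a · r)` (`isOreFormula_iff`). As `g
xʲ = q⁻ʲ xʲ g`, this follows from the one-step recursion `x h · r = w (h · r - g h · r)` for all `h`
in `A[x, σ]`, and conversely implies it.

In a partial action the recursion is forced (`act_X_mul`): the element `y = g⁻¹ x` satisfies `y · s
= s (y · 1)`, and evaluating `y · (g h · r)` in two ways expresses `x h · r`. Condition 2 then comes
from expanding `a · w`, using `a x = x τ(a)` and `g · 1 = 0`.

For the converse, fix all arguments of an axiom except the element `h` that acts. Both sides become
linear maps `θ` with `θ(x h) = w (θ(h) - θ(g h))`: this property survives convolution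
(`sweedlerMul_X_mul`) and determines `θ` from its values on `A` (`linearMap_ext_of_skew`). Only `h =
a` in `A` remains, where condition 2 and the compatibility of `τ` with `Δ` reduce the axioms to
those of `A`. -/

noncomputable section

/-! ### Normal form in the Ore extension, with coefficients on the right. -/

section OreAlgebra

variable {k A : Type*} [Field k] [Ring A] [Algebra k A]

namespace OreExt

theorem X_pow_mul_C (σ : A ≃ₐ[k] A) (n : ℕ) (a : A) :
    X σ ^ n * C σ a = C σ ((σ ^ n : A ≃ₐ[k] A) a) * X σ ^ n := by
  induction n with
  | zero => simp
  | succ n ih =>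
    rw [pow_succ', mul_assoc, ih, ← mul_assoc, X_mul_C, mul_assoc, pow_succ' σ,
      AlgEquiv.mul_apply]

theorem C_mul_X_pow (σ : A ≃ₐ[k] A) (n : ℕ) (a : A) :
    C σ a * X σ ^ n = X σ ^ n * C σ ((σ.symm ^ n : A ≃ₐ[k] A) a) := by
  have h : σ ^ n * σ.symm ^ n = 1 := by
    change σ ^ n * σ⁻¹ ^ n = 1
    rw [inv_pow, mul_inv_cancel]
  rw [X_pow_mul_C, ← AlgEquiv.mul_apply, h, AlgEquiv.one_apply]

@[elab_as_elim]
theorem induction_on (σ : A ≃ₐ[k] A) {motive : OreExt σ → Prop} (p : OreExt σ)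
    (X_pow_mul_C : ∀ (j : ℕ) (a : A), motive (X σ ^ j * C σ a))
    (add : ∀ p q, motive p → motive q → motive (p + q)) : motive p := by
  have key : ∀ p : SkewPolynomial (OreCoeff σ), motive p := by
    intro p
    induction p using SkewPolynomial.induction with
    | h0 =>
      have h := X_pow_mul_C 0 0
      rw [map_zero, mul_zero] at h
      exact h
    | ha n a p _ _ hp =>
      have h1 : (SkewPolynomial.C a : SkewPolynomial (OreCoeff σ)) * SkewPolynomial.X ^ n =
          SkewPolynomial.monomial n a := @SkewPolynomial.C_mul_X_pow_eq_monomial _ _ a _ n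
      -- The induction principle for skew polynomials supplies left coefficients; moving `b` past
      -- `xⁿ` replaces it by `σ⁻ⁿ(b)`.
      have h2 : ∀ b : A, motive (C σ b * X σ ^ n) := fun b => by
        rw [C_mul_X_pow]; exact X_pow_mul_C _ _
      rw [← h1]
      exact add _ _ (h2 a) hp
  exact key p

/-- Linear maps that agree on all `xʲ a` are equal. -/
theorem linearMap_ext (σ : A ≃ₐ[k] A) [Module k (OreExt σ)] {M : Type*} [AddCommMonoid M]
    [Module k M] {f f' : OreExt σ →ₗ[k] M}
    (h : ∀ (j : ℕ) (a : A), f (X σ ^ j * C σ a) = f' (X σ ^ j * C σ a)) : f = f' :=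
  LinearMap.ext fun p => induction_on σ p h fun p q hp hq => by rw [map_add, map_add, hp, hq]

end OreExt

end OreAlgebra

/-! ### Convolution products and the axioms of partial actions. -/

section SweedlerMul

variable {k H R : Type*} [Field k] [Ring H] [Bialgebra k H] [Ring R] [Algebra k R]

/-- The convolution product `h ↦ φ(h₁) ψ(h₂)`. -/
def sweedlerMul (φ ψ : H →ₗ[k] R) : H →ₗ[k] R :=
  LinearMap.mul' k R ∘ₗ TensorProduct.map φ ψ ∘ₗ Coalgebra.comul

theorem sweedlerMul_apply (φ ψ : H →ₗ[k] R) (h : H) :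
    sweedlerMul φ ψ h = LinearMap.mul' k R (TensorProduct.map φ ψ (Coalgebra.comul h)) := rfl

theorem sweedlerMul_of_isGroupLikeElem (φ ψ : H →ₗ[k] R) {g : H} (hg : IsGroupLikeElem k g) :
    sweedlerMul φ ψ g = φ g * ψ g := by
  rw [sweedlerMul_apply, hg.comul_eq_tmul_self]; simp

theorem sweedlerMul_comp {B : Type*} [Ring B] [Bialgebra k B] (f : B →ₐc[k] H)
    (φ ψ : H →ₗ[k] R) :
    sweedlerMul φ ψ ∘ₗ (f : B →ₗ[k] H) =
      sweedlerMul (φ ∘ₗ (f : B →ₗ[k] H)) (ψ ∘ₗ (f : B →ₗ[k] H)) := by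
  ext b
  have h : Coalgebra.comul (R := k) (f b) = TensorProduct.map (f : B →ₗ[k] H) (f : B →ₗ[k] H)
      (Coalgebra.comul (R := k) b) := (CoalgHomClass.map_comp_comul_apply f b).symm
  change sweedlerMul φ ψ (f b) = _
  rw [sweedlerMul_apply, h, ← LinearMap.comp_apply (TensorProduct.map φ ψ),
    ← TensorProduct.map_comp]
  rfl

/-- Left multiplication by a group-like element distributes over convolution. -/
theorem sweedlerMul_mul_left {g : H} (hg : IsGroupLikeElem k g) (φ ψ : H →ₗ[k] R) (h : H) :
    sweedlerMul φ ψ (g * h) =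
      sweedlerMul (φ ∘ₗ LinearMap.mulLeft k g) (ψ ∘ₗ LinearMap.mulLeft k g) h := by
  rw [sweedlerMul_apply, sweedlerMul_apply, Bialgebra.comul_mul, hg.comul_eq_tmul_self]
  generalize Coalgebra.comul (R := k) h = t
  induction t with
  | zero => simp
  | tmul a b => simp
  | add s t hs ht => simp only [mul_add, map_add, hs, ht]

/-- Convolution and left multiplication by a skew-primitive element. -/
theorem sweedlerMul_skew_mul_left {a b x : H}
    (hx : Coalgebra.comul (R := k) x = x ⊗ₜ[k] a + b ⊗ₜ[k] x)
    (φ ψ : H →ₗ[k] R) (h : H) :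
    sweedlerMul φ ψ (x * h) =
      sweedlerMul (φ ∘ₗ LinearMap.mulLeft k x) (ψ ∘ₗ LinearMap.mulLeft k a) h +
      sweedlerMul (φ ∘ₗ LinearMap.mulLeft k b) (ψ ∘ₗ LinearMap.mulLeft k x) h := by
  simp only [sweedlerMul_apply, Bialgebra.comul_mul, hx]
  generalize Coalgebra.comul (R := k) h = t
  induction t with
  | zero => simp
  | tmul a b => simp [add_mul]
  | add s t hs ht => simp only [mul_add, map_add, hs, ht]; abel

theorem sweedlerMul_skew (φ ψ : H →ₗ[k] R) {a b x : H}
    (hx : Coalgebra.comul (R := k) x = x ⊗ₜ[k] a + b ⊗ₜ[k] x) :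
    sweedlerMul φ ψ x = φ x * ψ a + φ b * ψ x := by
  rw [sweedlerMul_apply, hx]; simp

/-- Centrality of `w` is needed because the scalar has to pass the value of `φ`; in the left factor
it comes out for any `w`. -/
theorem sweedlerMul_mulLeft_comp {w : R} (hw : w ∈ Subalgebra.center k R) (φ ψ : H →ₗ[k] R) :
    sweedlerMul φ (LinearMap.mulLeft k w ∘ₗ ψ) = LinearMap.mulLeft k w ∘ₗ sweedlerMul φ ψ := by
  ext h
  simp only [sweedlerMul_apply, LinearMap.comp_apply]
  generalize Coalgebra.comul (R := k) h = t
  rw [Subalgebra.mem_center_iff] at hw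
  induction t with
  | zero => simp
  | tmul a b => simp only [TensorProduct.map_tmul, LinearMap.mul'_apply, LinearMap.comp_apply,
      LinearMap.mulLeft_apply, ← mul_assoc, hw]
  | add s t hs ht => simp only [map_add, hs, ht]

theorem mulLeft_comp_sweedlerMul (w : R) (φ ψ : H →ₗ[k] R) :
    sweedlerMul (LinearMap.mulLeft k w ∘ₗ φ) ψ = LinearMap.mulLeft k w ∘ₗ sweedlerMul φ ψ := by
  ext h
  simp only [sweedlerMul_apply, LinearMap.comp_apply]
  generalize Coalgebra.comul (R := k) h = t
  induction t with
  | zero => simp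
  | tmul a b => simp [mul_assoc]
  | add s t hs ht => simp only [map_add, hs, ht]

theorem sweedlerMul_add_left (φ φ' ψ : H →ₗ[k] R) :
    sweedlerMul (φ + φ') ψ = sweedlerMul φ ψ + sweedlerMul φ' ψ := by
  ext h; simp [sweedlerMul_apply, TensorProduct.map_add_left]

theorem sweedlerMul_sub_left (φ φ' ψ : H →ₗ[k] R) :
    sweedlerMul (φ - φ') ψ = sweedlerMul φ ψ - sweedlerMul φ' ψ := by
  rw [eq_sub_iff_add_eq, ← sweedlerMul_add_left, sub_add_cancel]

theorem sweedlerMul_add_right (φ ψ ψ' : H →ₗ[k] R) :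
    sweedlerMul φ (ψ + ψ') = sweedlerMul φ ψ + sweedlerMul φ ψ' := by
  ext h; simp [sweedlerMul_apply, TensorProduct.map_add_right]

theorem sweedlerMul_sub_right (φ ψ ψ' : H →ₗ[k] R) :
    sweedlerMul φ (ψ - ψ') = sweedlerMul φ ψ - sweedlerMul φ ψ' := by
  rw [eq_sub_iff_add_eq, ← sweedlerMul_add_right, sub_add_cancel]

namespace IsPartialAction

variable {act : H →ₗ[k] R →ₗ[k] R}

theorem act_mul_eq (h : IsPartialAction act) (a : H) (r s : R) :
    act a (r * s) = sweedlerMul (act.flip r) (act.flip s) a := h.act_mul a r s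

theorem act_act_eq (h : IsPartialAction act) (a b : H) (r : R) :
    act a (act b r) = sweedlerMul (act.flip 1) (act.flip r ∘ₗ LinearMap.mulRight k b) a :=
  h.act_act a b r

theorem act_eq_sweedlerMul (h : IsPartialAction act) (a : H) (r : R) :
    act a r = sweedlerMul (act.flip 1) (act.flip r) a := by
  rw [← h.act_mul_eq, one_mul]

/-- A group-like element that kills `1` acts by zero. -/
theorem act_eq_zero_of_isGroupLikeElem (h : IsPartialAction act) {g : H}
    (hg : IsGroupLikeElem k g) (h1 : act g 1 = 0)
    (r : R) : act g r = 0 := by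
  rw [h.act_eq_sweedlerMul, sweedlerMul_of_isGroupLikeElem _ _ hg]; simp [h1]

theorem comp (h : IsPartialAction act) {B : Type*} [Ring B] [Bialgebra k B]
    (f : B →ₐc[k] H) :
    IsPartialAction (act ∘ₗ (f : B →ₗ[k] H)) where
  one_act r := by
    change act (f 1) r = r
    rw [map_one, h.one_act]
  act_mul b r s := (h.act_mul_eq (f b) r s).trans
    (LinearMap.congr_fun (sweedlerMul_comp f (act.flip r) (act.flip s)) b)
  act_act b c r := by
    refine (h.act_act_eq (f b) (f c) r).trans ((LinearMap.congr_fun (sweedlerMul_comp f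
      (act.flip 1) (act.flip r ∘ₗ LinearMap.mulRight k (f c))) b).trans ?_)
    refine congrArg (fun ψ => sweedlerMul _ ψ b) (LinearMap.ext fun d => ?_)
    change act (f d * f c) r = act (f (d * c)) r
    rw [map_mul f d c]

end IsPartialAction

theorem IsSymmetricPartialAction.comp {act : H →ₗ[k] R →ₗ[k] R}
    (h : IsSymmetricPartialAction act) {B : Type*} [Ring B] [Bialgebra k B] (f : B →ₐc[k] H) :
    IsSymmetricPartialAction (act ∘ₗ (f : B →ₗ[k] H)) where
  toIsPartialAction := h.toIsPartialAction.comp f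
  act_act_symm b c r := by
    refine (h.act_act_symm (f b) (f c) r).trans ((LinearMap.congr_fun (sweedlerMul_comp f
      (act.flip r ∘ₗ LinearMap.mulRight k (f c)) (act.flip 1)) b).trans ?_)
    refine congrArg (fun ψ => sweedlerMul ψ _ b) (LinearMap.ext fun d => ?_)
    change act (f d * f c) r = act (f (d * c)) r
    rw [map_mul f d c]

end SweedlerMul

/-! ### The q-binomial theorem for the products `fⱼ`. -/

section OreFactor

variable {k A : Type*} [Field k] [Ring A] [Algebra k A]

/-- The product `(1 - pʲ⁻¹ g) ⋯ (1 - p g) (1 - g)`. -/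
def oreFactor (p : k) (g : A) : ℕ → A
  | 0 => 1
  | j + 1 => oreFactor p g j - p ^ j • (g * oreFactor p g j)

theorem qBinom_zero_right (p : k) (n : ℕ) : qBinom p n 0 = 1 := by cases n <;> rfl

/-- The `p`-binomial formula for `oreFactor`. -/
theorem oreFactor_eq_sum (p : k) (g : A) (j : ℕ) : oreFactor p g j =
    ∑ i ∈ Finset.range (j + 1), ((-1) ^ i * p ^ (i * (i - 1) / 2) * qBinom p j i) • g ^ i := by
  induction j with
  | zero => simp [oreFactor, qBinom_zero_right]
  | succ j ih =>
    have h1 : ∀ i ∈ Finset.range (j + 1),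
        ((-1) ^ (i + 1) * p ^ ((i + 1) * (i + 1 - 1) / 2) * qBinom p (j + 1) (i + 1)) •
          g ^ (i + 1) =
        ((-1) ^ (i + 1) * p ^ ((i + 1) * (i + 1 - 1) / 2) * qBinom p j (i + 1)) • g ^ (i + 1) -
        p ^ j • (g * (((-1) ^ i * p ^ (i * (i - 1) / 2) * qBinom p j i) • g ^ i)) := by
      intro i hi
      have hij : i + (j - i) = j := by have := Finset.mem_range.mp hi; omega
      rw [mul_smul_comm, smul_smul, ← pow_succ', ← sub_smul, Nat.triangle_succ]
      congr 1
      -- The exponents match because `(i+1)i/2 = i(i-1)/2 + i` and `i + (j - i) = j`, the latter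
      -- needing `i ≤ j`.
      rw [show qBinom p (j + 1) (i + 1) =
        qBinom p j (i + 1) + p ^ (j - i) * qBinom p j i from rfl]
      conv_rhs => rw [← hij]
      rw [pow_add p i (j - i), hij]
      ring
    rw [Finset.sum_range_succ', Finset.sum_congr rfl h1, Finset.sum_sub_distrib,
      ← Finset.smul_sum, ← Finset.mul_sum, ← ih, oreFactor, sub_add_eq_add_sub]
    congr 1
    -- The sum for `j` is extended by the vanishing term `i = j + 1`, so that splitting off `i = 0`
    -- leaves the same index range as for `j + 1`.
    have h2 := Finset.sum_range_succ'
      (fun i => ((-1) ^ i * p ^ (i * (i - 1) / 2) * qBinom p j i) • g ^ i) (j + 1)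
    rw [Finset.sum_range_succ, qBinom_eq_zero_of_lt p j (j + 1) (Nat.lt_succ_self j), mul_zero,
      zero_smul, add_zero, ← ih] at h2
    rw [h2, qBinom_zero_right, qBinom_zero_right]

/-- A linear map that is invariant under moving `g` from the left to the right is invariant under
moving `oreFactor p g j`. -/
theorem map_oreFactor_mul {M : Type*} [AddCommGroup M] [Module k M] {φ : A →ₗ[k] M} {g : A}
    (hφ : ∀ a, φ (g * a) = φ (a * g)) (p : k) (j : ℕ) (a : A) :
    φ (oreFactor p g j * a) = φ (a * oreFactor p g j) := by
  induction j generalizing a with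
  | zero => simp [oreFactor]
  | succ j ih =>
    simp only [oreFactor, sub_mul, mul_sub, map_sub, ih, smul_mul_assoc, mul_smul_comm, map_smul]
    -- `φ(g f a) = φ(f a g) = φ(a g f)`, with the induction hypothesis taken at `a g`.
    rw [mul_assoc, hφ, mul_assoc, ih, mul_assoc]

theorem map_pow_mul {M : Type*} [AddCommGroup M] [Module k M] {φ : A →ₗ[k] M} {g : A}
    (hφ : ∀ a, φ (g * a) = φ (a * g)) (j : ℕ) (a : A) : φ (g ^ j * a) = φ (a * g ^ j) := by
  induction j generalizing a with
  | zero => simp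
  | succ j ih => rw [pow_succ', mul_assoc, hφ, mul_assoc, ih, mul_assoc]

end OreFactor

/-! ### Compatibility of `σ⁻¹` with the coproduct. -/

namespace HopfOreExtension

variable {k A : Type*} [Field k] [Ring A] [HopfAlgebra k A] {σ : A ≃ₐ[k] A} {g : A}
  [HopfAlgebra k (OreExt σ)]

theorem C_smul (E : HopfOreExtension σ g) (c : k) (a : A) :
    OreExt.C σ (c • a) = c • OreExt.C σ a := by
  rw [← E.incl_apply, ← E.incl_apply, map_smul]

theorem isGroupLike_C (E : HopfOreExtension σ g) : IsGroupLikeElem k (OreExt.C σ g) := by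
  rw [← E.incl_apply]; exact E.isGroupLike.map E.incl

theorem sigma_groupLike (E : HopfOreExtension σ g) : σ g = oreCharacter σ g • g := by
  rw [E.sigma_eq, E.isGroupLike.comul_eq_tmul_self]; simp

theorem oreCharacter_ne_zero (E : HopfOreExtension σ g) : oreCharacter σ g ≠ 0 :=
  (E.isGroupLike.isUnit.map (oreCharacter σ)).ne_zero

theorem symm_pow_groupLike (E : HopfOreExtension σ g) (n : ℕ) :
    (σ.symm ^ n : A ≃ₐ[k] A) g = (oreCharacter σ g)⁻¹ ^ n • g := by
  induction n with
  | zero => simp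
  | succ n ih =>
    have h : σ.symm g = (oreCharacter σ g)⁻¹ • g := by
      rw [AlgEquiv.symm_apply_eq, map_smul, E.sigma_groupLike, smul_smul,
        inv_mul_cancel₀ E.oreCharacter_ne_zero, one_smul]
    rw [pow_succ', AlgEquiv.mul_apply, ih, map_smul, h, smul_smul, pow_succ]

/-- Since `σ(g) = q g`, each `x` passed by `g` costs a factor `q⁻¹`; this is the source of the
powers of `q⁻¹` in `oreFactor`. -/
theorem C_groupLike_mul (E : HopfOreExtension σ g) (j : ℕ) (a : A) :
    OreExt.C σ g * (OreExt.X σ ^ j * OreExt.C σ a) =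
      (oreCharacter σ g)⁻¹ ^ j • (OreExt.X σ ^ j * OreExt.C σ (g * a)) := by
  rw [← mul_assoc, OreExt.C_mul_X_pow, E.symm_pow_groupLike, E.C_smul, mul_smul_comm,
    smul_mul_assoc, mul_assoc, ← map_mul]

/-- Inverts and iterates `Δ(σ(a)) = σ(a₁) ⊗ a₂`, the first identity of `comul_mul_map`. -/
theorem comul_symm_pow (E : HopfOreExtension σ g) (n : ℕ) (a : A) :
    Coalgebra.comul (R := k) ((σ.symm ^ n : A ≃ₐ[k] A) a) =
      TensorProduct.map (σ.symm ^ n : A ≃ₐ[k] A).toLinearMap LinearMap.id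
        (Coalgebra.comul (R := k) a) := by
  have h1 : ∀ b, Coalgebra.comul (R := k) (σ.symm b) =
      TensorProduct.map σ.symm.toLinearMap LinearMap.id (Coalgebra.comul (R := k) b) := by
    intro b
    conv_rhs => rw [← σ.apply_symm_apply b, (E.comul_mul_map _).1]
    generalize Coalgebra.comul (R := k) (σ.symm b) = t
    induction t with
    | zero => simp
    | tmul x y => simp
    | add x y hx hy => simp only [map_add, ← hx, ← hy]
  induction n with
  | zero =>
    generalize h : Coalgebra.comul (R := k) a = t
    rw [pow_zero, AlgEquiv.one_apply, h]
    exact (LinearMap.congr_fun (TensorProduct.map_id (R := k) (M := A) (N := A)) t).symm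
  | succ n ih =>
    rw [pow_succ', AlgEquiv.mul_apply, h1, ih]
    generalize Coalgebra.comul (R := k) a = t
    induction t with
    | zero => simp
    | tmul x y => simp
    | add x y hx hy => simp only [map_add, hx, hy]

/-- The second identity of `comul_mul_map`, taken at `σ⁻¹(a)` and hit with `id ⊗ σ⁻¹`, is the case
`n = 1`. Applying `σ⁻¹` to the right tensor factor instead of the left thus amounts to conjugating
the left factor by `g`. -/
theorem map_symm_pow_comul_mul (E : HopfOreExtension σ g) (n : ℕ) (a : A) :
    Algebra.TensorProduct.map (AlgHom.id k A) (σ.symm ^ n : A ≃ₐ[k] A).toAlgHom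
        (Coalgebra.comul (R := k) a) * (g ^ n) ⊗ₜ[k] (1 : A) =
      (g ^ n) ⊗ₜ[k] (1 : A) * Coalgebra.comul (R := k) ((σ.symm ^ n : A ≃ₐ[k] A) a) := by
  have h1 : ∀ b, Algebra.TensorProduct.map (AlgHom.id k A) σ.symm.toAlgHom
      (Coalgebra.comul (R := k) b) * g ⊗ₜ[k] (1 : A) =
      g ⊗ₜ[k] (1 : A) * Coalgebra.comul (R := k) (σ.symm b) := by
    intro b
    have h := congrArg (Algebra.TensorProduct.map (AlgHom.id k A) σ.symm.toAlgHom)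
      (E.comul_mul_map (σ.symm b)).2
    rw [σ.apply_symm_apply, map_mul, map_mul] at h
    have h2 : Algebra.TensorProduct.map (AlgHom.id k A) σ.symm.toAlgHom (g ⊗ₜ[k] (1 : A)) =
      g ⊗ₜ[k] (1 : A) := by simp
    rw [h2] at h
    rw [h]
    congr 1
    generalize Coalgebra.comul (R := k) (σ.symm b) = t
    induction t with
    | zero => simp
    | tmul x y => simp
    | add x y hx hy => simp only [map_add, hx, hy]
  induction n with
  | zero =>
    have h : Algebra.TensorProduct.map (AlgHom.id k A) (σ.symm ^ 0 : A ≃ₐ[k] A).toAlgHom =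
      AlgHom.id k (A ⊗[k] A) := by ext <;> simp
    rw [h, pow_zero, pow_zero, ← Algebra.TensorProduct.one_def]
    simp
  | succ n ih =>
    have h2 : Algebra.TensorProduct.map (AlgHom.id k A) (σ.symm ^ (n + 1) : A ≃ₐ[k] A).toAlgHom =
        (Algebra.TensorProduct.map (AlgHom.id k A) σ.symm.toAlgHom).comp
          (Algebra.TensorProduct.map (AlgHom.id k A) (σ.symm ^ n : A ≃ₐ[k] A).toAlgHom) := by
      rw [pow_succ']
      ext <;> simp
    have h3 : (g ^ (n + 1)) ⊗ₜ[k] (1 : A) = (g ^ n) ⊗ₜ[k] (1 : A) * g ⊗ₜ[k] (1 : A) := by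
      simp [pow_succ]
    have h4 : Algebra.TensorProduct.map (AlgHom.id k A) σ.symm.toAlgHom
        ((g ^ n) ⊗ₜ[k] (1 : A)) * g ⊗ₜ[k] (1 : A) = (g ^ (n + 1)) ⊗ₜ[k] (1 : A) := by
      simp [pow_succ]
    have h5 := congrArg (Algebra.TensorProduct.map (AlgHom.id k A) σ.symm.toAlgHom) ih
    rw [map_mul, map_mul] at h5
    rw [h2, AlgHom.comp_apply, ← h4, ← mul_assoc, h5, mul_assoc, h1, pow_succ' σ.symm,
      AlgEquiv.mul_apply, ← mul_assoc, h4, h3]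

variable {R : Type*} [Ring R] [Algebra k R]

/-- `φ(τⁿ a₁) ψ(a₂) = (φ * ψ)(τⁿ a)` for `τ = σ⁻¹`. -/
theorem sweedlerMul_comp_symm_pow_left (E : HopfOreExtension σ g) (φ ψ : A →ₗ[k] R) (n : ℕ)
    (a : A) : sweedlerMul (φ ∘ₗ (σ.symm ^ n : A ≃ₐ[k] A).toLinearMap) ψ a =
      sweedlerMul φ ψ ((σ.symm ^ n : A ≃ₐ[k] A) a) := by
  rw [sweedlerMul_apply, sweedlerMul_apply, E.comul_symm_pow,
    ← LinearMap.comp_apply (TensorProduct.map φ ψ), ← TensorProduct.map_comp,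
    LinearMap.comp_id]

/-- `φ(a₁) ψ(τⁿ a₂) = (φ * ψ)(τⁿ a)` for `τ = σ⁻¹`, if `φ` is invariant under moving `g`. -/
theorem sweedlerMul_comp_symm_pow_right (E : HopfOreExtension σ g) {φ : A →ₗ[k] R}
    (hφ : ∀ a, φ (g * a) = φ (a * g)) (ψ : A →ₗ[k] R) (n : ℕ)
    (a : A) : sweedlerMul φ (ψ ∘ₗ (σ.symm ^ n : A ≃ₐ[k] A).toLinearMap) a =
      sweedlerMul φ ψ ((σ.symm ^ n : A ≃ₐ[k] A) a) := by
  obtain ⟨u, hu⟩ := E.isGroupLike.isUnit.pow n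
  -- Invariance under moving `g` makes `φ` invariant under conjugation by `u = gⁿ`, so the
  -- conjugation in `map_symm_pow_comul_mul` disappears.
  have h1 : ∀ t : A ⊗[k] A, TensorProduct.map φ ψ
      (((u⁻¹ : Aˣ) : A) ⊗ₜ[k] (1 : A) * (t * (u : A) ⊗ₜ[k] (1 : A))) = TensorProduct.map φ ψ t := by
    intro t
    induction t with
    | zero => simp
    | tmul x y =>
      simp only [Algebra.TensorProduct.tmul_mul_tmul, one_mul, mul_one, TensorProduct.map_tmul]
      rw [← mul_assoc, hu, ← map_pow_mul hφ, ← hu, u.mul_inv_cancel_left]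
    | add x y hx hy => simp only [add_mul, mul_add, map_add, hx, hy]
  have h2 := E.map_symm_pow_comul_mul n a
  rw [← hu] at h2
  rw [sweedlerMul_apply, sweedlerMul_apply]
  congr 1
  have h3 := congrArg (fun t => TensorProduct.map φ ψ (((u⁻¹ : Aˣ) : A) ⊗ₜ[k] (1 : A) * t)) h2
  rw [h1, ← mul_assoc, Algebra.TensorProduct.tmul_mul_tmul, u.inv_mul, one_mul,
    ← Algebra.TensorProduct.one_def, one_mul] at h3
  rw [← h3]
  generalize Coalgebra.comul (R := k) a = t
  induction t with
  | zero => simp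
  | tmul x y => simp
  | add x y hx hy => simp only [map_add, hx, hy]

end HopfOreExtension

/-! ### The recursion for `x h` and the necessity of conditions 2 and 3. -/

namespace HopfOreExtension

variable {k A : Type*} [Field k] [Ring A] [HopfAlgebra k A] {σ : A ≃ₐ[k] A} {g : A}
  [HopfAlgebra k (OreExt σ)] {R : Type*} [Ring R] [Algebra k R]
  {act : OreExt σ →ₗ[k] R →ₗ[k] R}

/-- The restriction of `act` to the coefficient algebra. -/
def restrict (E : HopfOreExtension σ g) (act : OreExt σ →ₗ[k] R →ₗ[k] R) :
    A →ₗ[k] R →ₗ[k] R :=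
  act ∘ₗ (E.incl : A →ₗ[k] OreExt σ)

theorem restrict_apply (E : HopfOreExtension σ g) (a : A) :
    E.restrict act a = act (OreExt.C σ a) :=
  congrArg act (E.incl_apply a)

theorem flip_comp_incl (E : HopfOreExtension σ g) (r : R) :
    act.flip r ∘ₗ (E.incl : A →ₗ[k] OreExt σ) = (E.restrict act).flip r := rfl

theorem sweedlerMul_C (E : HopfOreExtension σ g) (φ ψ : OreExt σ →ₗ[k] R) (a : A) :
    sweedlerMul φ ψ (OreExt.C σ a) = sweedlerMul (φ ∘ₗ (E.incl : A →ₗ[k] OreExt σ))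
      (ψ ∘ₗ (E.incl : A →ₗ[k] OreExt σ)) a := by
  rw [← sweedlerMul_comp, ← E.incl_apply]
  rfl

/-- For a central element `w`, the extension formula says that `xʲ a` acts as
`wʲ (1 - q¹⁻ʲ g) ⋯ (1 - q⁻¹ g) (1 - g) a`. -/
theorem isOreFormula_iff (E : HopfOreExtension σ g) (q : k) {w : R}
    (hw : w ∈ Subalgebra.center k R) :
    IsOreFormula σ g act q w ↔ ∀ (j : ℕ) (a : A) (r : R),
      act (OreExt.X σ ^ j * OreExt.C σ a) r = w ^ j * E.restrict act (oreFactor q⁻¹ g j * a) r := by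
  refine forall₃_congr fun j a r => ?_
  rw [oreFactor_eq_sum, Finset.sum_mul, map_sum, LinearMap.sum_apply, Finset.mul_sum]
  refine Eq.congr_right (Finset.sum_congr rfl fun i hi => ?_)
  have hij : i + (j - i) = j := by have := Finset.mem_range.mp hi; omega
  rw [smul_mul_assoc, map_smul, LinearMap.smul_apply, mul_smul_comm, E.restrict_apply, mul_assoc,
    (Subalgebra.mem_center_iff.mp (Subalgebra.pow_mem _ hw i)), ← mul_assoc (w ^ i), ← pow_add, hij]

/-- In a partial action, `x h · r = w (h · r) - (g h · r) w`, where `w = x · 1`. -/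
theorem act_X_mul (E : HopfOreExtension σ g) (h : IsPartialAction act)
    (hg : act (OreExt.C σ g) 1 = 0) (p : OreExt σ) (r : R) :
    act (OreExt.X σ * p) r =
      act (OreExt.X σ) 1 * act p r - act (OreExt.C σ g * p) r * act (OreExt.X σ) 1 := by
  obtain ⟨u, hu⟩ := E.isGroupLike.isUnit
  have hu' : IsGroupLikeElem k ((u⁻¹ : Aˣ) : A) := by
    rw [isGroupLikeElem_unitsInv, hu]; exact E.isGroupLike
  have hGi : IsGroupLikeElem k (OreExt.C σ ((u⁻¹ : Aˣ) : A)) := by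
    rw [← E.incl_apply]; exact hu'.map E.incl
  have hgr := h.act_eq_zero_of_isGroupLikeElem E.isGroupLike_C hg
  have hmul : OreExt.C σ ((u⁻¹ : Aˣ) : A) * OreExt.C σ g = 1 := by
    rw [← map_mul, ← hu, u.inv_mul, map_one]
  -- `0 = g⁻¹ · (g · 1) = (g⁻¹ · 1)(g⁻¹ g · 1) = g⁻¹ · 1`.
  have hi1 : act (OreExt.C σ ((u⁻¹ : Aˣ) : A)) 1 = 0 := by
    have h1 := h.act_act_eq (OreExt.C σ ((u⁻¹ : Aˣ) : A)) (OreExt.C σ g) 1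
    rw [sweedlerMul_of_isGroupLikeElem _ _ hGi] at h1
    simpa [hgr, hmul, h.one_act] using h1.symm
  -- `Δ(y) = y ⊗ g⁻¹ + 1 ⊗ y` and `g⁻¹ · 1 = 0`, so in `y · (s 1)` only the term `s (y · 1)`
  -- survives.
  set y := OreExt.C σ ((u⁻¹ : Aˣ) : A) * OreExt.X σ with hy
  have hcy : Coalgebra.comul (R := k) y =
      y ⊗ₜ[k] OreExt.C σ ((u⁻¹ : Aˣ) : A) + 1 ⊗ₜ[k] y := by
    rw [hy, Bialgebra.comul_mul, hGi.comul_eq_tmul_self, E.comul_X, mul_add,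
      Algebra.TensorProduct.tmul_mul_tmul, Algebra.TensorProduct.tmul_mul_tmul, mul_one, hmul]
  have hyr : ∀ s, act y s = s * act y 1 := by
    intro s
    have h1 := h.act_mul_eq y s 1
    rw [sweedlerMul_skew _ _ hcy] at h1
    simpa [hi1, h.one_act] using h1
  have hyg : ∀ p, y * (OreExt.C σ g * p) = oreCharacter σ g • (OreExt.X σ * p) := by
    intro p
    rw [hy, mul_assoc, ← mul_assoc (OreExt.X σ), OreExt.X_mul_C, E.sigma_groupLike, E.C_smul,
      smul_mul_assoc, smul_mul_assoc, mul_smul_comm, mul_assoc (OreExt.C σ g), ← mul_assoc _ _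
      (OreExt.X σ * p), hmul, one_mul]
  -- Compares `y · (g p · r) = (g p · r)(y · 1)` with its expansion `(y · 1)(p · r) + (y g p · r)`,
  -- where `y g = q x`.
  have key : ∀ p r, oreCharacter σ g • act (OreExt.X σ * p) r =
      act (OreExt.C σ g * p) r * act y 1 - act y 1 * act p r := by
    intro p r
    have h1 := h.act_act_eq y (OreExt.C σ g * p) r
    rw [sweedlerMul_skew _ _ hcy, hyr] at h1
    simp only [LinearMap.flip_apply, LinearMap.comp_apply, LinearMap.mulRight_apply, hyg, map_smul,
      h.one_act, one_mul] at h1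
    rw [← mul_assoc, hmul, one_mul] at h1
    rw [h1, add_sub_cancel_left]
  -- The case `p = 1`, `r = 1` of `key`, where `g · 1 = 0`, identifies `y · 1` as `-q w`.
  have hy1 : act y 1 = -(oreCharacter σ g • act (OreExt.X σ) 1) := by
    have h1 := key 1 1
    simp only [mul_one, hgr, zero_mul, h.one_act, zero_sub] at h1
    rw [h1, neg_neg]
  have h2 := key p r
  rw [hy1, mul_neg, neg_mul, mul_smul_comm, smul_mul_assoc, sub_neg_eq_add, neg_add_eq_sub,
    ← smul_sub] at h2
  exact (IsUnit.mk0 _ E.oreCharacter_ne_zero).smul_left_cancel.mp h2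

/-- The recursion for `x h` gives the formula for `xʲ a`. -/
theorem act_X_pow_mul_C (E : HopfOreExtension σ g) {w : R} (hw : w ∈ Subalgebra.center k R)
    (h : ∀ p r, act (OreExt.X σ * p) r = w * act p r - act (OreExt.C σ g * p) r * w)
    (j : ℕ) (a : A) (r : R) : act (OreExt.X σ ^ j * OreExt.C σ a) r =
      w ^ j * E.restrict act (oreFactor (oreCharacter σ g)⁻¹ g j * a) r := by
  induction j generalizing a with
  | zero => simp [oreFactor, restrict_apply]
  | succ j ih =>
    rw [pow_succ', mul_assoc, h, E.C_groupLike_mul, map_smul, LinearMap.smul_apply, ih, ih,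
      Subalgebra.mem_center_iff.mp hw, oreFactor, sub_mul, map_sub, LinearMap.sub_apply, mul_sub,
      smul_mul_assoc, map_smul, LinearMap.smul_apply, mul_smul_comm, mul_smul_comm, pow_succ']
    -- The recursion produces `fⱼ g`, the definition of `oreFactor` has `g fⱼ`; they agree because
    -- `fⱼ` is a polynomial in `g`.
    have hc : Commute (oreFactor (oreCharacter σ g)⁻¹ g j) g := by
      rw [oreFactor_eq_sum]
      exact Commute.sum_left _ _ _ fun i _ => ((Commute.refl g).pow_left i).smul_left _
    rw [← mul_assoc _ g a, hc.eq, mul_assoc w, mul_assoc w]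

/-- Conversely, the formula for `xʲ a` gives the recursion for `x h`. -/
theorem act_X_mul_of_act_X_pow_mul_C (E : HopfOreExtension σ g) {w : R}
    (h : ∀ (j : ℕ) (a : A) (r : R), act (OreExt.X σ ^ j * OreExt.C σ a) r =
      w ^ j * E.restrict act (oreFactor (oreCharacter σ g)⁻¹ g j * a) r) (p : OreExt σ) (r : R) :
    act (OreExt.X σ * p) r = w * (act p r - act (OreExt.C σ g * p) r) := by
  have key : act.flip r ∘ₗ LinearMap.mulLeft k (OreExt.X σ) = LinearMap.mulLeft k w ∘ₗ
      (act.flip r - act.flip r ∘ₗ LinearMap.mulLeft k (OreExt.C σ g)) := by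
    refine OreExt.linearMap_ext σ fun j a => ?_
    have hc : Commute (oreFactor (oreCharacter σ g)⁻¹ g j) g := by
      rw [oreFactor_eq_sum]
      exact Commute.sum_left _ _ _ fun i _ => ((Commute.refl g).pow_left i).smul_left _
    simp only [LinearMap.comp_apply, LinearMap.mulLeft_apply, LinearMap.flip_apply,
      LinearMap.sub_apply]
    rw [← mul_assoc, ← pow_succ', h, E.C_groupLike_mul, map_smul, LinearMap.smul_apply, h, h,
      oreFactor, sub_mul, map_sub, LinearMap.sub_apply, smul_mul_assoc, map_smul,
      LinearMap.smul_apply, ← mul_assoc _ g a, hc.eq, pow_succ', mul_sub, mul_sub]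
    simp only [mul_assoc, mul_smul_comm]
  exact LinearMap.congr_fun key p

/-- Linear maps `θ` with `θ(x h) = w (θ(h) - θ(g h))` are determined by their values on `A`. -/
theorem linearMap_ext_of_skew (E : HopfOreExtension σ g) {w : R} {θ θ' : OreExt σ →ₗ[k] R}
    (hθ : ∀ p, θ (OreExt.X σ * p) = w * (θ p - θ (OreExt.C σ g * p)))
    (hθ' : ∀ p, θ' (OreExt.X σ * p) = w * (θ' p - θ' (OreExt.C σ g * p)))
    (h : ∀ a, θ (OreExt.C σ a) = θ' (OreExt.C σ a)) : θ = θ' := by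
  refine OreExt.linearMap_ext σ fun j => ?_
  induction j with
  | zero => simpa using h
  | succ j ih =>
    intro a
    -- `g xʲ a` is a multiple of `xʲ (g a)`, so the induction hypothesis applies at both `a` and `g
    -- a`.
    rw [pow_succ', mul_assoc, hθ, hθ', E.C_groupLike_mul, map_smul, map_smul, ih, ih]

/-- The property `θ(x h) = w (θ(h) - θ(g h))` passes to convolution products. -/
theorem sweedlerMul_X_mul (E : HopfOreExtension σ g) {w : R} (hw : w ∈ Subalgebra.center k R)
    {φ ψ : OreExt σ →ₗ[k] R}
    (hφ : ∀ p, φ (OreExt.X σ * p) = w * (φ p - φ (OreExt.C σ g * p)))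
    (hψ : ∀ p, ψ (OreExt.X σ * p) = w * (ψ p - ψ (OreExt.C σ g * p))) (p : OreExt σ) :
    sweedlerMul φ ψ (OreExt.X σ * p) =
      w * (sweedlerMul φ ψ p - sweedlerMul φ ψ (OreExt.C σ g * p)) := by
  have h1 : φ ∘ₗ LinearMap.mulLeft k (OreExt.X σ) =
      LinearMap.mulLeft k w ∘ₗ (φ - φ ∘ₗ LinearMap.mulLeft k (OreExt.C σ g)) :=
    LinearMap.ext hφ
  have h2 : ψ ∘ₗ LinearMap.mulLeft k (OreExt.X σ) =
      LinearMap.mulLeft k w ∘ₗ (ψ - ψ ∘ₗ LinearMap.mulLeft k (OreExt.C σ g)) :=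
    LinearMap.ext hψ
  have h3 : ψ ∘ₗ LinearMap.mulLeft k (1 : OreExt σ) = ψ := by ext; simp
  -- With `φ_g(h) = φ(g h)`, the coproduct of `x` gives `w ((φ - φ_g) * ψ + φ_g * (ψ - ψ_g))`, which
  -- telescopes to `w (φ * ψ - φ_g * ψ_g)`.
  rw [sweedlerMul_skew_mul_left E.comul_X, h1, h2, h3, sweedlerMul_mulLeft_comp hw,
    mulLeft_comp_sweedlerMul, sweedlerMul_mul_left E.isGroupLike_C, sweedlerMul_sub_left,
    sweedlerMul_sub_right]
  simp only [LinearMap.comp_apply, LinearMap.mulLeft_apply, LinearMap.sub_apply]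
  rw [← mul_add, sub_add_sub_cancel]

/-- For `τ = σ⁻¹`, a partial action satisfies `a · w = (τ(a) · 1) w`, where `w = x · 1`. -/
theorem act_C_act_X (E : HopfOreExtension σ g) (h : IsPartialAction act)
    (hx : act (OreExt.X σ) 1 ∈ Subalgebra.center k R)
    (hg : act (OreExt.C σ g) 1 = 0)
    (hcomm : ∀ (a : A) (r : R),
      act (OreExt.C σ (g * a)) r = act (OreExt.C σ (a * g)) r) (a : A) :
    act (OreExt.C σ a) (act (OreExt.X σ) 1) =
      act (OreExt.C σ (σ.symm a)) 1 * act (OreExt.X σ) 1 := by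
  set w := act (OreExt.X σ) 1 with hwdef
  have hA : IsPartialAction (E.restrict act) := h.comp E.incl
  have hcomm' : ∀ (r : R) (a : A), (E.restrict act).flip r (g * a) =
      (E.restrict act).flip r (a * g) := by
    intro r a
    simp only [LinearMap.flip_apply, E.restrict_apply, hcomm]
  have h0 : ∀ r, E.restrict act g r = 0 := by
    intro r
    rw [E.restrict_apply]
    exact h.act_eq_zero_of_isGroupLikeElem E.isGroupLike_C hg r
  -- `b x = x τ(b)` and the recursion give `w (τ(b) · 1 - g τ(b) · 1)`. Moving `g` to the right of
  -- `τ(b)` lets its contribution reassemble into `τ(a) · (g · 1) = 0`.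
  have h1 : (act.flip 1 ∘ₗ LinearMap.mulRight k (OreExt.X σ)) ∘ₗ (E.incl : A →ₗ[k] OreExt σ) =
      LinearMap.mulLeft k w ∘ₗ ((E.restrict act).flip 1 - (E.restrict act).flip 1 ∘ₗ
        LinearMap.mulRight k g) ∘ₗ (σ.symm ^ 1 : A ≃ₐ[k] A).toLinearMap := by
    ext b
    change act (E.incl b * OreExt.X σ) 1 =
      w * (E.restrict act ((σ.symm ^ 1 : A ≃ₐ[k] A) b) 1 -
        E.restrict act ((σ.symm ^ 1 : A ≃ₐ[k] A) b * g) 1)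
    rw [E.incl_apply, ← pow_one (OreExt.X σ), OreExt.C_mul_X_pow, pow_one (OreExt.X σ),
      E.act_X_mul h hg, ← map_mul, E.restrict_apply, E.restrict_apply, hcomm, mul_sub, ← hwdef,
      Subalgebra.mem_center_iff.mp hx]
  rw [h.act_act_eq, E.sweedlerMul_C, E.flip_comp_incl, h1, sweedlerMul_mulLeft_comp hx, LinearMap.comp_apply,
    E.sweedlerMul_comp_symm_pow_right (hcomm' 1), sweedlerMul_sub_right, LinearMap.sub_apply,
    ← hA.act_act_eq, ← hA.act_eq_sweedlerMul, h0, map_zero, sub_zero, pow_one,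
    LinearMap.mulLeft_apply, E.restrict_apply, Subalgebra.mem_center_iff.mp hx]

/-! ### Sufficiency of the conditions. -/

section Converse

variable {w : R}

/-- If `a · w = (τ(a) · 1) w`, then `a · (wʲ s) = wʲ (τʲ(a) · s)`, where `τ = σ⁻¹`. -/
theorem act_C_pow_mul (E : HopfOreExtension σ g) (hA : IsPartialAction (E.restrict act))
    (hw : w ∈ Subalgebra.center k R)
    (h2 : ∀ a : A, E.restrict act a w = E.restrict act (σ.symm a) 1 * w)
    (j : ℕ) (a : A) (s : R) :
    E.restrict act a (w ^ j * s) = w ^ j * E.restrict act ((σ.symm ^ j : A ≃ₐ[k] A) a) s := by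
  induction j generalizing a with
  | zero => simp
  | succ j ih =>
    have h3 : (E.restrict act).flip w = LinearMap.mulLeft k w ∘ₗ
        ((E.restrict act).flip 1 ∘ₗ (σ.symm ^ 1 : A ≃ₐ[k] A).toLinearMap) := by
      ext b
      change E.restrict act b w = w * E.restrict act ((σ.symm ^ 1 : A ≃ₐ[k] A) b) 1
      rw [h2, pow_one, Subalgebra.mem_center_iff.mp hw]
    -- One step is `a · (w s) = w (τ(a₁) · 1)(a₂ · s) = w (τ(a) · s)`.
    rw [pow_succ', mul_assoc, hA.act_mul_eq, h3, mulLeft_comp_sweedlerMul, LinearMap.comp_apply,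
      E.sweedlerMul_comp_symm_pow_left, ← hA.act_eq_sweedlerMul, LinearMap.mulLeft_apply, ih,
      pow_one, mul_assoc, pow_succ σ.symm, AlgEquiv.mul_apply]

/-- The maps `a ↦ a xⁱ b · r` on `A`, for an action given by the extension formula. -/
theorem flip_comp_mulRight_comp_incl (E : HopfOreExtension σ g)
    (hcomm : ∀ (r : R) (a : A), (E.restrict act).flip r (g * a) =
      (E.restrict act).flip r (a * g))
    (h3 : ∀ (j : ℕ) (a : A) (r : R), act (OreExt.X σ ^ j * OreExt.C σ a) r =
      w ^ j * E.restrict act (oreFactor (oreCharacter σ g)⁻¹ g j * a) r)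
    (j : ℕ) (b : A) (r : R) :
    (act.flip r ∘ₗ LinearMap.mulRight k (OreExt.X σ ^ j * OreExt.C σ b)) ∘ₗ
        (E.incl : A →ₗ[k] OreExt σ) =
      LinearMap.mulLeft k (w ^ j) ∘ₗ ((E.restrict act).flip r ∘ₗ
        LinearMap.mulRight k (b * oreFactor (oreCharacter σ g)⁻¹ g j)) ∘ₗ
        (σ.symm ^ j : A ≃ₐ[k] A).toLinearMap := by
  ext c
  change act (E.incl c * (OreExt.X σ ^ j * OreExt.C σ b)) r = w ^ j *
    (E.restrict act).flip r ((σ.symm ^ j : A ≃ₐ[k] A) c *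
      (b * oreFactor (oreCharacter σ g)⁻¹ g j))
  rw [E.incl_apply, ← mul_assoc, OreExt.C_mul_X_pow, mul_assoc, ← map_mul, h3, ← mul_assoc _ b,
    ← map_oreFactor_mul (hcomm r), LinearMap.flip_apply]

/-- The factor `fⱼ` is placed to the right of `b` to match the form of
`flip_comp_mulRight_comp_incl`, so that the axiom of `A` applies with `l = b fⱼ`. -/
theorem act_C_act_X_pow_mul_C (E : HopfOreExtension σ g)
    (hA : IsPartialAction (E.restrict act)) (hw : w ∈ Subalgebra.center k R)
    (hcomm : ∀ (r : R) (a : A), (E.restrict act).flip r (g * a) =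
      (E.restrict act).flip r (a * g))
    (h2 : ∀ a : A, E.restrict act a w = E.restrict act (σ.symm a) 1 * w)
    (h3 : ∀ (j : ℕ) (a : A) (r : R), act (OreExt.X σ ^ j * OreExt.C σ a) r =
      w ^ j * E.restrict act (oreFactor (oreCharacter σ g)⁻¹ g j * a) r)
    (a : A) (j : ℕ) (b : A) (r : R) :
    act (OreExt.C σ a) (act (OreExt.X σ ^ j * OreExt.C σ b) r) =
      w ^ j * E.restrict act ((σ.symm ^ j : A ≃ₐ[k] A) a)
        (E.restrict act (b * oreFactor (oreCharacter σ g)⁻¹ g j) r) := by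
  have h4 := map_oreFactor_mul (hcomm r) (oreCharacter σ g)⁻¹ j b
  rw [LinearMap.flip_apply, LinearMap.flip_apply] at h4
  rw [h3, ← E.restrict_apply, E.act_C_pow_mul hA hw h2, h4]

/-- By linearity `l = xʲ b`. Both sides then equal `wʲ` times the two sides of the same axiom for
`τʲ(a)` and `b fⱼ` in `A`; here `τʲ` sits on the second Sweedler factor, so invariance of `a ↦ a ·
1` under moving `g` is used. -/
theorem act_act_C (E : HopfOreExtension σ g) (hA : IsPartialAction (E.restrict act))
    (hw : w ∈ Subalgebra.center k R)
    (hcomm : ∀ (r : R) (a : A), (E.restrict act).flip r (g * a) =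
      (E.restrict act).flip r (a * g))
    (h2 : ∀ a : A, E.restrict act a w = E.restrict act (σ.symm a) 1 * w)
    (h3 : ∀ (j : ℕ) (a : A) (r : R), act (OreExt.X σ ^ j * OreExt.C σ a) r =
      w ^ j * E.restrict act (oreFactor (oreCharacter σ g)⁻¹ g j * a) r)
    (a : A) (l : OreExt σ) (r : R) : act (OreExt.C σ a) (act l r) =
      sweedlerMul (act.flip 1) (act.flip r ∘ₗ LinearMap.mulRight k l) (OreExt.C σ a) := by
  induction l using OreExt.induction_on σ with
  | X_pow_mul_C j b =>
    rw [E.act_C_act_X_pow_mul_C hA hw hcomm h2 h3, E.sweedlerMul_C, E.flip_comp_incl,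
      E.flip_comp_mulRight_comp_incl hcomm h3,
      sweedlerMul_mulLeft_comp (Subalgebra.pow_mem _ hw j), LinearMap.comp_apply,
      E.sweedlerMul_comp_symm_pow_right (hcomm 1), ← hA.act_act_eq, LinearMap.mulLeft_apply]
  | add p q hp hq =>
    have h4 : act.flip r ∘ₗ LinearMap.mulRight k (p + q) =
        act.flip r ∘ₗ LinearMap.mulRight k p + act.flip r ∘ₗ LinearMap.mulRight k q := by
      ext; simp [mul_add]
    rw [h4, sweedlerMul_add_right, LinearMap.add_apply, ← hp, ← hq, map_add,
      LinearMap.add_apply, map_add]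

/-- As for `act_act_C`, but `τʲ` and `wʲ` now sit on the first Sweedler factor and come out
directly. -/
theorem act_act_symm_C (E : HopfOreExtension σ g)
    (hA : IsSymmetricPartialAction (E.restrict act))
    (hw : w ∈ Subalgebra.center k R)
    (hcomm : ∀ (r : R) (a : A), (E.restrict act).flip r (g * a) =
      (E.restrict act).flip r (a * g))
    (h2 : ∀ a : A, E.restrict act a w = E.restrict act (σ.symm a) 1 * w)
    (h3 : ∀ (j : ℕ) (a : A) (r : R), act (OreExt.X σ ^ j * OreExt.C σ a) r =
      w ^ j * E.restrict act (oreFactor (oreCharacter σ g)⁻¹ g j * a) r)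
    (a : A) (l : OreExt σ) (r : R) : act (OreExt.C σ a) (act l r) =
      sweedlerMul (act.flip r ∘ₗ LinearMap.mulRight k l) (act.flip 1) (OreExt.C σ a) := by
  induction l using OreExt.induction_on σ with
  | X_pow_mul_C j b =>
    rw [E.act_C_act_X_pow_mul_C hA.toIsPartialAction hw hcomm h2 h3, E.sweedlerMul_C, E.flip_comp_incl,
      E.flip_comp_mulRight_comp_incl hcomm h3, mulLeft_comp_sweedlerMul, LinearMap.comp_apply,
      E.sweedlerMul_comp_symm_pow_left, LinearMap.mulLeft_apply]
    exact congrArg (w ^ j * ·) (hA.act_act_symm _ _ r)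
  | add p q hp hq =>
    have h4 : act.flip r ∘ₗ LinearMap.mulRight k (p + q) =
        act.flip r ∘ₗ LinearMap.mulRight k p + act.flip r ∘ₗ LinearMap.mulRight k q := by
      ext; simp [mul_add]
    rw [h4, sweedlerMul_add_left, LinearMap.add_apply, ← hp, ← hq, map_add,
      LinearMap.add_apply, map_add]

/-- The maps `h ↦ h l · r` inherit the recursion for `x h`. -/
theorem act_flip_mulRight_X_mul (h : ∀ p r, act (OreExt.X σ * p) r =
      w * (act p r - act (OreExt.C σ g * p) r)) (l : OreExt σ) (r : R) (p : OreExt σ) :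
    (act.flip r ∘ₗ LinearMap.mulRight k l) (OreExt.X σ * p) =
      w * ((act.flip r ∘ₗ LinearMap.mulRight k l) p -
        (act.flip r ∘ₗ LinearMap.mulRight k l) (OreExt.C σ g * p)) := by
  simp only [LinearMap.comp_apply, LinearMap.mulRight_apply, LinearMap.flip_apply, mul_assoc, h]

/-- In the two multiplicative axioms both sides obey the recursion in the acting element, so each
need only be compared on `A`. -/
theorem isPartialAction_of_restrict (E : HopfOreExtension σ g)
    (hA : IsPartialAction (E.restrict act))
    (hw : w ∈ Subalgebra.center k R)
    (hcomm : ∀ (r : R) (a : A), (E.restrict act).flip r (g * a) =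
      (E.restrict act).flip r (a * g))
    (h2 : ∀ a : A, E.restrict act a w = E.restrict act (σ.symm a) 1 * w)
    (h3 : ∀ (j : ℕ) (a : A) (r : R), act (OreExt.X σ ^ j * OreExt.C σ a) r =
      w ^ j * E.restrict act (oreFactor (oreCharacter σ g)⁻¹ g j * a) r) :
    IsPartialAction act where
  one_act r := by
    rw [← map_one (OreExt.C σ), ← E.restrict_apply, hA.one_act]
  act_mul p r s := by
    have h := E.act_X_mul_of_act_X_pow_mul_C h3
    refine LinearMap.congr_fun (E.linearMap_ext_of_skew (θ := act.flip (r * s))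
      (θ' := sweedlerMul (act.flip r) (act.flip s)) (fun p => h p _)
      (E.sweedlerMul_X_mul hw (fun p => h p _) (fun p => h p _)) fun a => ?_) p
    rw [LinearMap.flip_apply, ← E.restrict_apply, hA.act_mul_eq, E.sweedlerMul_C, E.flip_comp_incl,
      E.flip_comp_incl]
  act_act p l r := by
    have h := E.act_X_mul_of_act_X_pow_mul_C h3
    exact LinearMap.congr_fun (E.linearMap_ext_of_skew (θ := act.flip (act l r))
      (θ' := sweedlerMul (act.flip 1) (act.flip r ∘ₗ LinearMap.mulRight k l)) (fun p => h p _)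
      (E.sweedlerMul_X_mul hw (fun p => h p _) (act_flip_mulRight_X_mul h l r))
      fun a => E.act_act_C hA hw hcomm h2 h3 a l r) p

theorem isSymmetricPartialAction_of_restrict (E : HopfOreExtension σ g)
    (hA : IsSymmetricPartialAction (E.restrict act))
    (hw : w ∈ Subalgebra.center k R)
    (hcomm : ∀ (r : R) (a : A), (E.restrict act).flip r (g * a) =
      (E.restrict act).flip r (a * g))
    (h2 : ∀ a : A, E.restrict act a w = E.restrict act (σ.symm a) 1 * w)
    (h3 : ∀ (j : ℕ) (a : A) (r : R), act (OreExt.X σ ^ j * OreExt.C σ a) r =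
      w ^ j * E.restrict act (oreFactor (oreCharacter σ g)⁻¹ g j * a) r) :
    IsSymmetricPartialAction act where
  toIsPartialAction := E.isPartialAction_of_restrict hA.toIsPartialAction hw hcomm h2 h3
  act_act_symm p l r := by
    have h := E.act_X_mul_of_act_X_pow_mul_C h3
    exact LinearMap.congr_fun (E.linearMap_ext_of_skew (θ := act.flip (act l r))
      (θ' := sweedlerMul (act.flip r ∘ₗ LinearMap.mulRight k l) (act.flip 1)) (fun p => h p _)
      (E.sweedlerMul_X_mul hw (act_flip_mulRight_X_mul h l r) (fun p => h p _))
      fun a => E.act_act_symm_C hA hw hcomm h2 h3 a l r) p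

end Converse

end HopfOreExtension

end

theorem mainTheorem4 {k A R : Type*} [Field k] [IsAlgClosed k] [CharZero k]
    [Ring A] [HopfAlgebra k A] [Ring R] [Algebra k R]
    (σ : A ≃ₐ[k] A) (g : A) [HopfAlgebra k (OreExt σ)] (E : HopfOreExtension σ g)
    (act : OreExt σ →ₗ[k] R →ₗ[k] R)
    (hx : act (OreExt.X σ) 1 ∈ Subalgebra.center k R)
    (hg : act (OreExt.C σ g) 1 = 0)
    (hcomm : ∀ (a : A) (r : R),
      act (OreExt.C σ (g * a)) r = act (OreExt.C σ (a * g)) r) :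
    (IsPartialAction act ↔
      IsPartialAction (act ∘ₗ (E.incl : A →ₗ[k] OreExt σ)) ∧
      (∀ a : A, act (OreExt.C σ a) (act (OreExt.X σ) 1) =
        act (OreExt.C σ (σ.symm a)) 1 * act (OreExt.X σ) 1) ∧
      IsOreFormula σ g act (oreCharacter σ g) (act (OreExt.X σ) 1)) ∧
    (IsSymmetricPartialAction act ↔
      IsSymmetricPartialAction (act ∘ₗ (E.incl : A →ₗ[k] OreExt σ)) ∧
      (∀ a : A, act (OreExt.C σ a) (act (OreExt.X σ) 1) =
        act (OreExt.C σ (σ.symm a)) 1 * act (OreExt.X σ) 1) ∧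
      IsOreFormula σ g act (oreCharacter σ g) (act (OreExt.X σ) 1)) := by
  have hcomm' : ∀ (r : R) (a : A), (E.restrict act).flip r (g * a) =
      (E.restrict act).flip r (a * g) := by
    intro r a
    rw [LinearMap.flip_apply, LinearMap.flip_apply, E.restrict_apply, E.restrict_apply, hcomm]
  have h2 : (∀ a : A, act (OreExt.C σ a) (act (OreExt.X σ) 1) =
      act (OreExt.C σ (σ.symm a)) 1 * act (OreExt.X σ) 1) →
      ∀ a : A, E.restrict act a (act (OreExt.X σ) 1) =
        E.restrict act (σ.symm a) 1 * act (OreExt.X σ) 1 := by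
    intro h a
    rw [E.restrict_apply, E.restrict_apply, h]
  have h3 := E.isOreFormula_iff (act := act) (oreCharacter σ g) hx
  refine ⟨⟨fun h => ⟨h.comp E.incl, E.act_C_act_X h hx hg hcomm,
      h3.mpr (E.act_X_pow_mul_C hx (E.act_X_mul h hg))⟩,
    fun h => E.isPartialAction_of_restrict h.1 hx hcomm' (h2 h.2.1) (h3.mp h.2.2)⟩,
    ⟨fun h => ⟨h.comp E.incl, E.act_C_act_X h.toIsPartialAction hx hg hcomm,
      h3.mpr (E.act_X_pow_mul_C hx (E.act_X_mul h.toIsPartialAction hg))⟩,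
    fun h => E.isSymmetricPartialAction_of_restrict h.1 hx hcomm' (h2 h.2.1) (h3.mp h.2.2)⟩⟩
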